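/- Let $n\in\{0,1,2,\dots\}$ and $a,b,c\in\mathbb{C}$ with $b\notin\{-1,-2,-3,\dots\}$. For $x\in\mathbb C$ and an integer $k\ge 0$ put $\binom{x}{k}=x(x-1)\cdots(x-k+1)/k!$, and for complex $x,y$ put $\binom{x}{y}=\frac{\Gamma(x+1)}{\Gamma(y+1)\Gamma(x-y+1)}$. Let ${}_2F_1$ and ${}_3F_2$ denote the hypergeometric functions, given by the usual power series for $|z|<1$ and by analytic continuation to $\mathbb{C}\setminus[1,\infty)$, with the limiting values from below ($\operatorname{Im} z\to 0^-$) on the cut $(1,\infty)$; let $\log$ be the principal logarithm and $\psi=\Gamma'/\Gamma$. Write $$S=\sum_{j=0}^{n}\sum_{i=0}^{j}\frac{\binom{n+a+1}{i}}{\binom{n+b}{j}}\,c^{\,i-j}.$$ (1) We have $$\frac{1}{n+b+1}\,S=\frac{1}{b+1}\sum_{k=0}^{n}\sum_{j=0}^{k}\frac{\binom{k+a}{j}}{\binom{k+b+1}{k}}\,c^{\,j-k}$$ (if $c=0$, then $c^0=1$ and the terms with a negative power of $c$ are omitted on both sides). (2) If $a-b$ is not a negative integer and $c\notin\{-1,0\}$,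 then $$\frac{(a-b)(c+1)}{(n+b+1)c}\,S=\frac{\binom{n+a+1}{a}}{\binom{n+b+1}{b}}\;{}_3F_2\!\left(1,a-b,n+a+2;\,a-b+1,a+1;\,\tfrac1{c+1}\right)-{}_2F_1\!\left(1,a-b;\,a-b+1;\,\tfrac1{c+1}\right),$$ where, if $a$ is a negative integer, the right-hand side is understood as its limit as $a'\to a$, $a'\ne a$ (with $a'$ in place of $a$). (3) If $a-b$ is a negative integer or $0$ and $c\notin\{-1,0\}$, then $$\frac{(c+1)^{b-a+1}}{(n+b+1)c}\,S=\frac{n+b+2}{(b+1)(c+1)}\;{}_3F_2\!\left(1,1,n+b+3;\,2,b+2;\,\tfrac1{c+1}\right)+\psi(n+b+2)-\psi(b+1)+\log\frac{c}{c+1}-\sum_{\ell=1}^{b-a}\frac{(c+1)^\ell}{\ell}\left(\frac{\Gamma(n+b+2-\ell)\,\Gamma(b+1)}{\Gamma(n+b+2)\,\Gamma(b+1-\ell)}-1\right),$$ where $1/\Gamma$ is $0$ at the poles of $\Gamma$, and, if $n+a+1$ is a negative integer (so that quotients of two poles of $\Gamma$ occur), the right-hand side is understood as its limit as $b'\to b$,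 $b'\neq b$ (with $b'$ in place of $b$ and the integer $b-a$ kept fixed). -/

import Mathlib

open scoped Topology

/-- `z` is a negative integer, i.e. `z ∈ {-1, -2, -3, …}`. -/
def IsNegInt (z : ℂ) : Prop := ∃ k : ℕ, z = -((k : ℂ) + 1)

/-- The binomial coefficient `x choose y` with two complex arguments,
`Γ(x+1) / (Γ(y+1) Γ(x-y+1))`. -/
noncomputable def gammaBinom (x y : ℂ) : ℂ :=
  Complex.Gamma (x + 1) / (Complex.Gamma (y + 1) * Complex.Gamma (x - y + 1))

/-- The Pochhammer symbol `(α)_k = α (α+1) ⋯ (α+k-1)`. -/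
noncomputable def poch (α : ℂ) (k : ℕ) : ℂ := (ascPochhammer ℂ k).eval α

/-- Power series coefficients of `₂F₁(a, b; c; z)`. -/
noncomputable def coeff2F1 (a b c : ℂ) (k : ℕ) : ℂ :=
  poch a k * poch b k / (poch c k * (k.factorial : ℂ))

/-- Power series coefficients of `₃F₂(a, b, c; d, e; z)`. -/
noncomputable def coeff3F2 (a b c d e : ℂ) (k : ℕ) : ℂ :=
  poch a k * poch b k * poch c k / (poch d k * poch e k * (k.factorial : ℂ))

/-- `F` is the principal branch of the analytic function defined in the open unit disc by the power
series `∑ u k * z ^ k`: it is the sum of the series for `|z| < 1`, it is holomorphic on the cut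
plane `ℂ \ [1, ∞)`, and on the open cut `(1, ∞)` it takes its limiting values from below (so that,
e.g., `log (1 - z)` with the principal logarithm is the principal branch of `-∑ z ^ k / k`).
This determines `F` uniquely on `ℂ \ {1}`. -/
structure IsPrincipalBranch (u : ℕ → ℂ) (F : ℂ → ℂ) : Prop where
  hasSum : ∀ z : ℂ, ‖z‖ < 1 → HasSum (fun k : ℕ => u k * z ^ k) (F z)
  differentiableOn : DifferentiableOn ℂ F {z : ℂ | 1 - z ∈ Complex.slitPlane}
  tendsto_below : ∀ x : ℝ, 1 < x →
    Filter.Tendsto F (𝓝[{z : ℂ | z.im < 0}] (x : ℂ)) (𝓝 (F (x : ℂ)))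

/-- The hypergeometric function `₂F₁(a, b; c; z)`, continued analytically to `ℂ \ {1}`. -/
noncomputable def hyp2F1 (a b c : ℂ) : ℂ → ℂ :=
  Classical.epsilon (IsPrincipalBranch (coeff2F1 a b c))

/-- The hypergeometric function `₃F₂(a, b, c; d, e; z)`, continued analytically to `ℂ \ {1}`. -/
noncomputable def hyp3F2 (a b c d e : ℂ) : ℂ → ℂ :=
  Classical.epsilon (IsPrincipalBranch (coeff3F2 a b c d e))

/-- The double sum `∑_{j=0}^n ∑_{i=0}^j (n+a+1 choose i) / (n+b choose j) * c^(i-j)`. -/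
noncomputable def doubleSum (n : ℕ) (a b c : ℂ) : ℂ :=
  ∑ j ∈ Finset.range (n + 1), ∑ i ∈ Finset.range (j + 1),
    Ring.choose ((n : ℂ) + a + 1) i / Ring.choose ((n : ℂ) + b) j * c ^ ((i : ℤ) - (j : ℤ))

/-- The closed form used when `a - b` is not a negative integer. -/
noncomputable def closedForm (n : ℕ) (a b c : ℂ) : ℂ :=
  gammaBinom ((n : ℂ) + a + 1) a / gammaBinom ((n : ℂ) + b + 1) b
      * hyp3F2 1 (a - b) ((n : ℂ) + a + 2) (a - b + 1) (a + 1) (1 / (c + 1))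
    - hyp2F1 1 (a - b) (a - b + 1) (1 / (c + 1))

/-- The closed form used when `b - a = m` is a non-negative integer. -/
noncomputable def closedFormInt (n m : ℕ) (b c : ℂ) : ℂ :=
  ((n : ℂ) + b + 2) / ((b + 1) * (c + 1))
      * hyp3F2 1 1 ((n : ℂ) + b + 3) 2 (b + 2) (1 / (c + 1))
    + Complex.digamma ((n : ℂ) + b + 2) - Complex.digamma (b + 1) + Complex.log (c / (c + 1))
    - ∑ l ∈ Finset.Icc 1 m, (c + 1) ^ l / (l : ℂ)
        * (Complex.Gamma ((n : ℂ) + b + 2 - l) * Complex.Gamma (b + 1)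
            / (Complex.Gamma ((n : ℂ) + b + 2) * Complex.Gamma (b + 1 - l)) - 1)

/-!
The double sum and both closed forms reduce to one finite sum of increments
`D_m(a) = m! / (b+1)_{m+1} * ∑_{i ≤ m} (m+a choose i) c ^ (i-m)`.

* By Pascal's rule for `(n+a+1 choose i)` and the Beta function recurrence for `1 / (n+b choose j)`,
  the normalised double sum `doubleSum n a b c / (n+b+1)` equals `∑_{m ≤ n} D_m(a)`
  (`normalised_doubleSum_eq`). This is the reduction to the single-type sum.
* Put `s = a - b` and `z = 1/(c+1)`, so `c = (1-z)/z`. The coefficients of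
  `₃F₂(1, s, n+a+2; s+1, a+1; z)` are `s/(s+k)` times a polynomial in `k`. Dividing by `s + k` is a
  telescoping sum (`poch_div_poch`), so this `₃F₂` is a constant times the sum of
  `₂F₁(1, s; s+1; z) = ∑ s/(s+k) z^k` and a rational function of `z` (`coeff3F2_eq`). Vandermonde's
  identity shows that the rational function is `(c+1)/c * ∑_{m ≤ n} D_m(a)`. In the closed form for
  `a - b` not a negative integer the two `₂F₁` cancel.
* For `a = b - m` the `₃F₂` is that of the previous case with `a = b + 1`. There the `₂F₁` is a
  logarithm, which cancels, and what remains is `∑_k D_k(b+1)`. Pascal's rule expresses `D_k(a+1)`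
  through `D_k(a)`; applying it `m + 1` times leads from `b + 1` down to `b - m`, and its boundary
  terms sum to the digamma difference and the Gamma quotients of the closed form.
* The exceptional parameters, where the closed form is read as a limit, are isolated, and finite sums
  of increments depend continuously on `a` and `b`.

The analytic input is that `∑ z^k/(s+k)` has a principal branch. For `1 < re s` the Euler integral
continues it to the cut plane. Its limits from below on the cut exist because `z ^ s` times the
function has the derivative `z^(s-1)/(1-z)`, which is holomorphic across the cut away from `1`
(`exists_tendsto_lerchIntegral`). Other `s` are reached by splitting off the first coefficients.
-/

open Complex MeasureTheory Set Filter

/-! ### Principal branches on the cut plane -/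

theorem isOpen_cutPlane : IsOpen {z : ℂ | 1 - z ∈ slitPlane} :=
  isOpen_slitPlane.preimage (by fun_prop)

theorem one_sub_mul_mem_slitPlane {z : ℂ} (hz : 1 - z ∈ slitPlane) {t : ℝ}
    (ht : t ∈ Icc (0 : ℝ) 1) : 1 - z * t ∈ slitPlane := by
  have := starConvex_one_slitPlane.add_smul_mem (y := -z)
    (by simpa [sub_eq_add_neg] using hz) ht.1 ht.2
  simpa [sub_eq_add_neg, mul_comm] using this

theorem isPreconnected_cutPlane : IsPreconnected {z : ℂ | 1 - z ∈ slitPlane} := by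
  have : StarConvex ℝ 0 {z : ℂ | 1 - z ∈ slitPlane} := by
    rw [starConvex_zero_iff]
    intro z hz t h0 h1
    simpa [mul_comm] using one_sub_mul_mem_slitPlane hz ⟨h0, h1⟩
  have h0 : (0 : ℂ) ∈ {z : ℂ | 1 - z ∈ slitPlane} := by simp
  exact (this.isPathConnected h0).isConnected.isPreconnected

theorem mem_cutPlane_of_norm_lt_one {z : ℂ} (hz : ‖z‖ < 1) : 1 - z ∈ slitPlane := by
  have := mem_slitPlane_of_norm_lt_one (z := -z) (by simpa using hz)
  simpa [sub_eq_add_neg] using this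

theorem mem_cutPlane_of_im_neg {z : ℂ} (hz : z.im < 0) : 1 - z ∈ slitPlane := by
  rw [mem_slitPlane_iff]; right; simp; exact hz.ne

theorem eq_ofReal_of_notMem_cutPlane {z : ℂ} (hz : 1 - z ∉ slitPlane) (h1 : z ≠ 1) :
    ∃ x : ℝ, 1 < x ∧ z = x := by
  rw [mem_slitPlane_iff] at hz
  push Not at hz
  simp at hz
  have hz' : z = (z.re : ℂ) := Complex.ext rfl (by simpa using hz.2)
  refine ⟨z.re, lt_of_le_of_ne hz.1 fun h => h1 ?_, hz'⟩
  rw [hz', ← h, ofReal_one]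

instance neBot_nhdsWithin_im_neg (x : ℝ) : (𝓝[{z : ℂ | z.im < 0}] (x : ℂ)).NeBot := by
  rw [← mem_closure_iff_nhdsWithin_neBot, closure_setOfPred_im_lt]
  simp

/-- Holomorphic on the plane cut along `[1, ∞)`, and equal on `(1, ∞)` to the limit from below:
the conditions of `IsPrincipalBranch` that do not mention the power series. -/
structure IsCutHolomorphic (F : ℂ → ℂ) : Prop where
  differentiableOn : DifferentiableOn ℂ F {z : ℂ | 1 - z ∈ slitPlane}
  tendsto_below : ∀ x : ℝ, 1 < x → Tendsto F (𝓝[{z : ℂ | z.im < 0}] (x : ℂ)) (𝓝 (F (x : ℂ)))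

namespace IsCutHolomorphic

theorem of_differentiableOn {F : ℂ → ℂ} (hF : DifferentiableOn ℂ F {1}ᶜ) : IsCutHolomorphic F where
  differentiableOn := hF.mono fun z hz h => by
    rw [mem_singleton_iff] at h; simp [h] at hz
  tendsto_below x hx := by
    have hx1 : (x : ℂ) ≠ 1 := by exact_mod_cast hx.ne'
    exact ((hF.differentiableAt (isOpen_compl_singleton.mem_nhds hx1)).continuousAt.tendsto).mono_left
      nhdsWithin_le_nhds

theorem add {F G : ℂ → ℂ} (hF : IsCutHolomorphic F) (hG : IsCutHolomorphic G) :
    IsCutHolomorphic fun z => F z + G z :=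
  ⟨hF.1.add hG.1, fun x hx => (hF.2 x hx).add (hG.2 x hx)⟩

theorem mul {F G : ℂ → ℂ} (hF : IsCutHolomorphic F) (hG : IsCutHolomorphic G) :
    IsCutHolomorphic fun z => F z * G z :=
  ⟨hF.1.mul hG.1, fun x hx => (hF.2 x hx).mul (hG.2 x hx)⟩

theorem const (w : ℂ) : IsCutHolomorphic fun _ => w :=
  of_differentiableOn (differentiableOn_const w)

end IsCutHolomorphic

theorem IsPrincipalBranch.isCutHolomorphic {u : ℕ → ℂ} {F : ℂ → ℂ} (h : IsPrincipalBranch u F) :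
    IsCutHolomorphic F := ⟨h.2, h.3⟩

/-- The principal branch is unique away from the branch point: the identity theorem on the cut
plane, and uniqueness of limits on the cut. -/
theorem IsPrincipalBranch.eq {u : ℕ → ℂ} {F G : ℂ → ℂ} (hF : IsPrincipalBranch u F)
    (hG : IsPrincipalBranch u G) {z : ℂ} (hz : z ≠ 1) : F z = G z := by
  have key : EqOn F G {z : ℂ | 1 - z ∈ slitPlane} := by
    refine (hF.differentiableOn.analyticOnNhd isOpen_cutPlane).eqOn_of_preconnected_of_eventuallyEq
      (hG.differentiableOn.analyticOnNhd isOpen_cutPlane) isPreconnected_cutPlane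
      (z₀ := 0) (by simp) ?_
    filter_upwards [Metric.ball_mem_nhds (0 : ℂ) one_pos] with w hw
    exact (hF.hasSum w (by simpa using hw)).unique (hG.hasSum w (by simpa using hw))
  by_cases h : 1 - z ∈ slitPlane
  · exact key h
  · obtain ⟨x, hx, rfl⟩ := eq_ofReal_of_notMem_cutPlane h hz
    refine tendsto_nhds_unique (hF.tendsto_below x hx) ((hG.tendsto_below x hx).congr' ?_)
    filter_upwards [self_mem_nhdsWithin] with w hw
    exact (key (mem_cutPlane_of_im_neg hw)).symm

/-- A holomorphic function on the cut plane that has limits from below on the cut can be redefined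
on the cut. -/
theorem exists_isCutHolomorphic {f : ℂ → ℂ}
    (hf : DifferentiableOn ℂ f {z : ℂ | 1 - z ∈ slitPlane})
    (hlim : ∀ x : ℝ, 1 < x → ∃ l, Tendsto f (𝓝[{z : ℂ | z.im < 0}] (x : ℂ)) (𝓝 l)) :
    ∃ F, IsCutHolomorphic F ∧ EqOn F f {z : ℂ | 1 - z ∈ slitPlane} := by
  classical
  let F : ℂ → ℂ := fun z =>
    if 1 - z ∈ slitPlane then f z else limUnder (𝓝[{z : ℂ | z.im < 0}] z) f
  have hEq : EqOn F f {z : ℂ | 1 - z ∈ slitPlane} := fun z hz => if_pos hz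
  refine ⟨F, ⟨hf.congr hEq, fun x hx => ?_⟩, hEq⟩
  have hx' : ¬ (1 - (x : ℂ) ∈ slitPlane) := by
    rw [mem_slitPlane_iff]; simp; exact hx.le
  have : F x = limUnder (𝓝[{z : ℂ | z.im < 0}] (x : ℂ)) f := if_neg hx'
  rw [this]
  refine (tendsto_nhds_limUnder (hlim x hx)).congr' ?_
  filter_upwards [self_mem_nhdsWithin] with w hw
  exact (hEq (mem_cutPlane_of_im_neg hw)).symm

/-! ### The principal branch of `∑ z ^ k / (s + k)` -/

/-- The Euler integral `∫₀¹ t ^ (s - 1) / (1 - z t) dt`, which for `1 < re s`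
and `‖z‖ < 1` is the sum of `∑ z ^ k / (s + k)`. -/
noncomputable def lerchIntegral (s z : ℂ) : ℂ :=
  ∫ t in (0 : ℝ)..1, (t : ℂ) ^ (s - 1) / (1 - z * t)

theorem hasDerivAt_lerchIntegral {s z : ℂ} (hs : 1 < s.re) (hz : 1 - z ∈ slitPlane) :
    HasDerivAt (lerchIntegral s) (∫ t in (0 : ℝ)..1, (t : ℂ) ^ s / (1 - z * t) ^ 2) z := by
  obtain ⟨r, hr, hsub⟩ := Metric.nhds_basis_closedBall.mem_iff.1 (isOpen_cutPlane.mem_nhds hz)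
  have hne : ∀ w ∈ Metric.closedBall z r, ∀ t ∈ Icc (0 : ℝ) 1, 1 - w * t ≠ 0 := fun w hw t ht =>
    slitPlane_ne_zero (one_sub_mul_mem_slitPlane (hsub hw) ht)
  have hc1 : Continuous fun t : ℝ => (t : ℂ) ^ (s - 1) :=
    continuous_ofReal_cpow_const (by simpa using hs)
  have hc2 : Continuous fun t : ℝ => (t : ℂ) ^ s :=
    continuous_ofReal_cpow_const (by linarith)
  have hcont1 : ∀ w ∈ Metric.closedBall z r,
      ContinuousOn (fun t : ℝ => (t : ℂ) ^ (s - 1) / (1 - w * t)) (Icc 0 1) := fun w hw =>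
    hc1.continuousOn.div (by fun_prop) (hne w hw)
  have hcont2 : ContinuousOn (fun p : ℂ × ℝ => (p.2 : ℂ) ^ s / (1 - p.1 * p.2) ^ 2)
      (Metric.closedBall z r ×ˢ Icc 0 1) :=
    (hc2.comp continuous_snd).continuousOn.div (by fun_prop)
      fun p hp => pow_ne_zero 2 (hne p.1 hp.1 p.2 hp.2)
  have hcont3 : ContinuousOn (fun t : ℝ => (t : ℂ) ^ s / (1 - z * t) ^ 2) (Icc 0 1) :=
    hc2.continuousOn.div (by fun_prop)
      fun t ht => pow_ne_zero 2 (hne z (Metric.mem_closedBall_self hr.le) t ht)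
  obtain ⟨C, hC⟩ := ((isCompact_closedBall z r).prod isCompact_Icc).exists_bound_of_continuousOn hcont2
  have hI : uIoc (0 : ℝ) 1 ⊆ Icc 0 1 := by
    rw [uIoc_of_le zero_le_one]; exact Ioc_subset_Icc_self
  have hu : uIcc (0 : ℝ) 1 = Icc 0 1 := uIcc_of_le zero_le_one
  refine (intervalIntegral.hasDerivAt_integral_of_dominated_loc_of_deriv_le
    (F := fun w t => (t : ℂ) ^ (s - 1) / (1 - w * t))
    (F' := fun w t => (t : ℂ) ^ s / (1 - w * t) ^ 2) (bound := fun _ => C)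
    (Metric.closedBall_mem_nhds z hr) ?_ ?_ ?_ ?_ ?_ ?_).2
  · filter_upwards [Metric.closedBall_mem_nhds z hr] with w hw
    exact ((hcont1 w hw).mono hI).aestronglyMeasurable measurableSet_uIoc
  · exact ContinuousOn.intervalIntegrable (by
      rw [hu]; exact hcont1 z (Metric.mem_closedBall_self hr.le))
  · exact (hcont3.mono hI).aestronglyMeasurable measurableSet_uIoc
  · exact ae_of_all _ fun t ht w hw => hC (w, t) ⟨hw, hI ht⟩
  · exact intervalIntegrable_const
  · refine ae_of_all _ fun t ht w hw => ?_
    have ht0 : (t : ℂ) ≠ 0 := by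
      rw [uIoc_of_le zero_le_one] at ht
      exact_mod_cast ht.1.ne'
    have h1 := hne w hw t (hI ht)
    have hd : HasDerivAt (fun w : ℂ => 1 - w * t) (-t) w := by
      simpa using ((hasDerivAt_id w).mul_const (t : ℂ)).const_sub 1
    have := (hasDerivAt_const w ((t : ℂ) ^ (s - 1))).div hd h1
    refine this.congr_deriv ?_
    have hp : (t : ℂ) ^ s = (t : ℂ) ^ (s - 1) * t := by
      rw [cpow_sub _ _ ht0, cpow_one]; field_simp
    rw [hp]; ring

/-- The hypergeometric differential equation, reduced to first order: it holds because
`s t ^ (s - 1) / (1 - z t) + z t ^ s / (1 - z t) ^ 2` is the `t`-derivative of `t ^ s / (1 - z t)`. -/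
theorem lerchIntegral_ode {s z : ℂ} (hs : 1 < s.re) (hz : 1 - z ∈ slitPlane) :
    z * (∫ t in (0 : ℝ)..1, (t : ℂ) ^ s / (1 - z * t) ^ 2) + s * lerchIntegral s z
      = 1 / (1 - z) := by
  have hne : ∀ t ∈ Icc (0 : ℝ) 1, 1 - z * t ≠ 0 := fun t ht =>
    slitPlane_ne_zero (one_sub_mul_mem_slitPlane hz ht)
  have hu : uIcc (0 : ℝ) 1 = Icc 0 1 := uIcc_of_le zero_le_one
  have hs0 : s ≠ 0 := by rintro rfl; simp at hs; linarith
  have hc1 : ContinuousOn (fun t : ℝ => (t : ℂ) ^ (s - 1) / (1 - z * t)) (Icc 0 1) :=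
    (continuous_ofReal_cpow_const (by simpa using hs)).continuousOn.div (by fun_prop) hne
  have hc2 : ContinuousOn (fun t : ℝ => (t : ℂ) ^ s / (1 - z * t) ^ 2) (Icc 0 1) :=
    (continuous_ofReal_cpow_const (by linarith)).continuousOn.div (by fun_prop)
      fun t ht => pow_ne_zero 2 (hne t ht)
  have hftc := intervalIntegral.integral_eq_sub_of_hasDerivAt_of_le (a := 0) (b := 1)
    (f := fun t : ℝ => (t : ℂ) ^ s / (1 - z * t))
    (f' := fun t : ℝ => z * ((t : ℂ) ^ s / (1 - z * t) ^ 2) + s * ((t : ℂ) ^ (s - 1) / (1 - z * t)))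
    zero_le_one
    ((continuous_ofReal_cpow_const (by linarith)).continuousOn.div (by fun_prop) hne)
    (fun t ht => by
      have h1 := hne t (Ioo_subset_Icc_self ht)
      have hd : HasDerivAt (fun t : ℝ => 1 - z * (t : ℂ)) (-z) t := by
        simpa using ((hasDerivAt_id t).ofReal_comp.const_mul z).const_sub 1
      have hp : HasDerivAt (fun t : ℝ => (t : ℂ) ^ s) (s * (t : ℂ) ^ (s - 1)) t :=
        hasDerivAt_ofReal_cpow_const ht.1.ne' hs0
      refine (hp.div hd h1).congr_deriv ?_
      field_simp
      ring)
    (ContinuousOn.intervalIntegrable (by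
      rw [hu]; exact (continuousOn_const.mul hc2).add (continuousOn_const.mul hc1)))
  rw [intervalIntegral.integral_add, intervalIntegral.integral_const_mul,
    intervalIntegral.integral_const_mul] at hftc
  · rw [lerchIntegral, hftc]
    simp [hs0]
  · exact ContinuousOn.intervalIntegrable (by rw [hu]; exact continuousOn_const.mul hc2)
  · exact ContinuousOn.intervalIntegrable (by rw [hu]; exact continuousOn_const.mul hc1)

theorem hasSum_lerchIntegral {s z : ℂ} (hs : 1 < s.re) (hz : ‖z‖ < 1) :
    HasSum (fun k : ℕ => 1 / (s + k) * z ^ k) (lerchIntegral s z) := by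
  have hc1 : Continuous fun t : ℝ => (t : ℂ) ^ (s - 1) :=
    continuous_ofReal_cpow_const (by simpa using hs)
  have hbd : ∀ t ∈ uIoc (0 : ℝ) 1, ‖z * t‖ ≤ ‖z‖ ∧ ‖(t : ℂ) ^ (s - 1)‖ ≤ 1 := fun t ht => by
    rw [uIoc_of_le zero_le_one] at ht
    constructor
    · rw [norm_mul, norm_real, Real.norm_of_nonneg ht.1.le]
      exact mul_le_of_le_one_right (norm_nonneg z) ht.2
    · rw [norm_cpow_eq_rpow_re_of_pos ht.1]
      exact Real.rpow_le_one ht.1.le ht.2 (by simpa using hs.le)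
  have hsum := intervalIntegral.hasSum_integral_of_dominated_convergence (μ := volume)
    (a := 0) (b := 1) (F := fun (k : ℕ) (t : ℝ) => (t : ℂ) ^ (s - 1) * (z * t) ^ k)
    (f := fun t : ℝ => (t : ℂ) ^ (s - 1) / (1 - z * t)) (fun k _ => ‖z‖ ^ k)
    (fun k => (hc1.mul (by fun_prop)).aestronglyMeasurable)
    (fun k => ae_of_all _ fun t ht => by
      rw [norm_mul, norm_pow, ← one_mul (‖z‖ ^ k)]
      exact mul_le_mul (hbd t ht).2 (pow_le_pow_left₀ (norm_nonneg _) (hbd t ht).1 k)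
        (by positivity) zero_le_one)
    (ae_of_all _ fun t _ => summable_geometric_of_lt_one (norm_nonneg z) hz)
    intervalIntegrable_const
    (ae_of_all _ fun t ht => by
      rw [div_eq_mul_inv]
      exact (hasSum_geometric_of_norm_lt_one ((hbd t ht).1.trans_lt hz)).mul_left _)
  convert! hsum using 1
  ext k
  have hk : s + k ≠ 0 := fun h => by
    have := congrArg re h
    simp at this
    linarith [(Nat.cast_nonneg k : (0 : ℝ) ≤ k)]
  have hint : ∫ t in (0 : ℝ)..1, (t : ℂ) ^ (s - 1) * (z * t) ^ k
      = ∫ t in (0 : ℝ)..1, z ^ k * (t : ℂ) ^ (s - 1 + k) := by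
    refine intervalIntegral.integral_congr_ae (ae_of_all _ fun t ht => ?_)
    rw [uIoc_of_le zero_le_one] at ht
    have ht0 : (t : ℂ) ≠ 0 := by exact_mod_cast ht.1.ne'
    rw [cpow_add _ _ ht0, cpow_natCast]; ring
  have hr : -1 < (s - 1 + k).re := by
    simp
    linarith [(Nat.cast_nonneg k : (0 : ℝ) ≤ k)]
  have he : s - 1 + k + 1 = s + k := by ring
  rw [hint, intervalIntegral.integral_const_mul, integral_cpow (Or.inl hr), he, ofReal_one, one_cpow,
    ofReal_zero, zero_cpow hk]
  ring

/-- The limits from below on the cut exist: near `x > 1` the function `z ^ s * lerchIntegral s z`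
is a primitive of `z ^ (s - 1) / (1 - z)` in the lower half plane, and the latter function is
holomorphic, hence has a primitive, in a full disc about `x`. -/
theorem exists_tendsto_lerchIntegral {s : ℂ} (hs : 1 < s.re) {x : ℝ} (hx : 1 < x) :
    ∃ l, Tendsto (lerchIntegral s) (𝓝[{z : ℂ | z.im < 0}] (x : ℂ)) (𝓝 l) := by
  set B := Metric.ball (x : ℂ) (x - 1) with hB
  have hre : ∀ z ∈ B, 1 < z.re := fun z hz => by
    have h1 : ‖z - x‖ < x - 1 := by simpa [hB, dist_eq_norm] using hz
    have h2 := (abs_re_le_norm (z - x)).trans_lt h1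
    have h3 := (abs_lt.1 h2).1
    simp at h3
    linarith
  have hslit : ∀ z ∈ B, z ∈ slitPlane := fun z hz => Or.inl (by linarith [hre z hz])
  have hne : ∀ z ∈ B, 1 - z ≠ 0 := fun z hz h => by
    have := congrArg re h
    simp at this
    linarith [hre z hz]
  have hhol : DifferentiableOn ℂ (fun z => z ^ (s - 1) / (1 - z)) B := fun z hz =>
    (((differentiableAt_id.cpow_const (hslit z hz))).div (by fun_prop)
      (hne z hz)).differentiableWithinAt
  obtain ⟨g, hg⟩ := hhol.isExactOn_ball
  have hxB : (x : ℂ) ∈ B := Metric.mem_ball_self (by linarith)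
  have hHopen : IsOpen (B ∩ {z : ℂ | z.im < 0}) :=
    Metric.isOpen_ball.inter (isOpen_lt continuous_im continuous_const)
  have hHconn : IsPreconnected (B ∩ {z : ℂ | z.im < 0}) :=
    ((convex_ball _ _).inter (convex_halfSpace_im_lt 0)).isPreconnected
  have hderiv : ∀ z ∈ B ∩ {z : ℂ | z.im < 0},
      HasDerivAt (fun z => z ^ s * lerchIntegral s z - g z) 0 z := fun z hz => by
    have hz0 : z ≠ 0 := slitPlane_ne_zero (hslit z hz.1)
    have hzc := mem_cutPlane_of_im_neg hz.2
    have hpow : HasDerivAt (fun z : ℂ => z ^ s) (s * z ^ (s - 1)) z := by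
      simpa using (hasDerivAt_id z).cpow_const (c := s) (hslit z hz.1)
    refine ((hpow.mul (hasDerivAt_lerchIntegral hs hzc)).sub (hg z hz.1)).congr_deriv ?_
    have hode := lerchIntegral_ode hs hzc
    have hp : z ^ s = z ^ (s - 1) * z := by
      rw [cpow_sub _ _ hz0, cpow_one]; field_simp
    beta_reduce
    rw [hp, div_eq_mul_one_div, ← hode]
    ring
  obtain ⟨C, hC⟩ := hHopen.exists_is_const_of_deriv_eq_zero hHconn
    (fun z hz => (hderiv z hz).differentiableAt.differentiableWithinAt)
    (fun z hz => (hderiv z hz).deriv)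
  have hcont : ContinuousAt (fun z => (C + g z) / z ^ s) (x : ℂ) := by
    refine (continuousAt_const.add (hg x hxB).continuousAt).div
      (differentiableAt_id.cpow_const (hslit x hxB)).continuousAt ?_
    rw [Ne, cpow_eq_zero_iff]
    exact fun h => slitPlane_ne_zero (hslit x hxB) h.1
  refine ⟨_, (hcont.tendsto.mono_left nhdsWithin_le_nhds).congr' ?_⟩
  filter_upwards [self_mem_nhdsWithin,
    mem_nhdsWithin_of_mem_nhds (Metric.isOpen_ball.mem_nhds hxB)] with z hz1 hz2
  have hzs : z ^ s ≠ 0 := by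
    rw [Ne, cpow_eq_zero_iff]
    exact fun h => slitPlane_ne_zero (hslit z hz2) h.1
  rw [← hC z ⟨hz2, hz1⟩]
  field_simp
  ring

theorem exists_isPrincipalBranch_of_one_lt_re {s : ℂ} (hs : 1 < s.re) :
    ∃ F, IsPrincipalBranch (fun k => 1 / (s + k)) F := by
  obtain ⟨F, hF, hEq⟩ := exists_isCutHolomorphic (f := lerchIntegral s)
    (fun z hz => (hasDerivAt_lerchIntegral hs hz).differentiableAt.differentiableWithinAt)
    (fun x hx => exists_tendsto_lerchIntegral hs hx)
  refine ⟨F, fun z hz => ?_, hF.1, hF.2⟩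
  rw [hEq (mem_cutPlane_of_norm_lt_one hz)]
  exact hasSum_lerchIntegral hs hz

/-- If the series with shifted coefficients has a principal branch, so has the original one. -/
theorem exists_isPrincipalBranch_of_succ {u : ℕ → ℂ}
    (h : ∃ F, IsPrincipalBranch (fun k => u (k + 1)) F) : ∃ F, IsPrincipalBranch u F := by
  obtain ⟨F, hF⟩ := h
  have hG := (IsCutHolomorphic.const (u 0)).add
    ((IsCutHolomorphic.of_differentiableOn differentiableOn_id).mul hF.isCutHolomorphic)
  refine ⟨_, fun z hz => ?_, hG.1, hG.2⟩
  rw [← hasSum_nat_add_iff' 1]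
  have := (hF.hasSum z hz).mul_left z
  convert! this using 1
  · ext k; ring
  · simp

theorem exists_isPrincipalBranch_one_div_add (s : ℂ) :
    ∃ F, IsPrincipalBranch (fun k => 1 / (s + k)) F := by
  obtain ⟨N, hN⟩ := exists_nat_gt (1 - s.re)
  have key : ∀ N : ℕ, ∀ s : ℂ, 1 - s.re < N →
      ∃ F, IsPrincipalBranch (fun k => 1 / (s + k)) F := by
    intro N
    induction N with
    | zero => exact fun s hs => exists_isPrincipalBranch_of_one_lt_re (by simp at hs; exact hs)
    | succ N ih =>
      intro s hs
      apply exists_isPrincipalBranch_of_succ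
      obtain ⟨F, hF⟩ := ih (s + 1) (by push_cast at hs; simp; linarith)
      refine ⟨F, ?_⟩
      convert hF using 3 with k
      push_cast; ring
  exact key N s hN

open Finset

/-! ### Binomial coefficients and Pochhammer symbols -/

theorem poch_zero (x : ℂ) : poch x 0 = 1 := by simp [poch]

theorem poch_succ (x : ℂ) (k : ℕ) : poch x (k + 1) = poch x k * (x + k) := by
  simp [poch, ascPochhammer_succ_eval]

theorem poch_succ_left (x : ℂ) (k : ℕ) : poch x (k + 1) = x * poch (x + 1) k := by
  simp [poch, ascPochhammer_succ_left, Polynomial.eval_comp]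

theorem poch_add (x : ℂ) (k l : ℕ) : poch x (k + l) = poch x k * poch (x + k) l := by
  induction l with
  | zero => simp [poch_zero]
  | succ l ih => rw [← add_assoc, poch_succ, ih, poch_succ]; push_cast; ring

theorem poch_one (k : ℕ) : poch 1 k = k.factorial := by simp [poch]

theorem poch_ne_zero {x : ℂ} (hx : ∀ k : ℕ, x + k ≠ 0) (k : ℕ) : poch x k ≠ 0 := by
  induction k with
  | zero => simp [poch_zero]
  | succ k ih => rw [poch_succ]; exact mul_ne_zero ih (hx k)

theorem continuous_poch (k : ℕ) : Continuous fun x => poch x k :=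
  (ascPochhammer ℂ k).continuous

theorem isNegInt_iff {z : ℂ} : IsNegInt z ↔ ∃ k : ℕ, z + 1 + k = 0 :=
  exists_congr fun k => ⟨fun h => by rw [h]; ring, fun h => by linear_combination h⟩

theorem add_one_add_natCast_ne_zero {z : ℂ} (hz : ¬ IsNegInt z) (k : ℕ) : z + 1 + k ≠ 0 :=
  fun h => hz (isNegInt_iff.2 ⟨k, h⟩)

theorem choose_eq_eval (x : ℂ) (k : ℕ) :
    Ring.choose x k = (descPochhammer ℂ k).eval x / k.factorial := by
  rw [Ring.choose_eq_smul, smul_eq_mul, div_eq_inv_mul,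
    Polynomial.descPochhammer_smeval_eq_ascPochhammer, Polynomial.ascPochhammer_smeval_eq_eval,
    descPochhammer_eval_eq_ascPochhammer]

theorem continuous_choose (k : ℕ) : Continuous fun x : ℂ => Ring.choose x k := by
  simp only [choose_eq_eval]
  exact (descPochhammer ℂ k).continuous.div_const _

theorem succ_mul_choose_succ (x : ℂ) (k : ℕ) :
    (k + 1) * Ring.choose x (k + 1) = (x - k) * Ring.choose x k := by
  rw [choose_eq_eval, choose_eq_eval, descPochhammer_succ_eval, Nat.factorial_succ]
  have : (k.factorial : ℂ) ≠ 0 := by exact_mod_cast k.factorial_ne_zero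
  have : (k + 1 : ℂ) ≠ 0 := by exact_mod_cast k.succ_ne_zero
  push_cast
  field_simp

theorem succ_mul_choose_succ_succ (x : ℂ) (k : ℕ) :
    (k + 1) * Ring.choose (x + 1) (k + 1) = (x + 1) * Ring.choose x k := by
  rw [Ring.choose_succ_succ, mul_add, succ_mul_choose_succ]; ring

theorem sub_mul_choose_add_one (x : ℂ) (k : ℕ) :
    (x + 1 - k) * Ring.choose (x + 1) k = (x + 1) * Ring.choose x k := by
  rw [← succ_mul_choose_succ, succ_mul_choose_succ_succ]

theorem factorial_mul_choose (x : ℂ) (k : ℕ) :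
    k.factorial * Ring.choose (k + x) k = poch (x + 1) k := by
  have : (k.factorial : ℂ) ≠ 0 := by exact_mod_cast k.factorial_ne_zero
  rw [choose_eq_eval, descPochhammer_eval_eq_ascPochhammer, poch]
  field_simp
  congr 1; ring

theorem choose_ne_zero {x : ℂ} {k : ℕ} (h : ∀ i < k, x - i ≠ 0) : Ring.choose x k ≠ 0 := by
  induction k with
  | zero => simp
  | succ k ih =>
    intro h0
    have := succ_mul_choose_succ x k
    rw [h0, mul_zero, eq_comm, mul_eq_zero] at this
    exact this.elim (h k (Nat.lt_succ_self k)) (ih fun i hi => h i (hi.trans (Nat.lt_succ_self k)))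

/-- The Beta function recurrence `B(j+1, x-j+2) + B(j+2, x-j+1) = B(j+1, x-j+1)`, written with
`1 / ((x + 1) * choose x j) = B(j+1, x-j+1)`. -/
theorem one_div_choose_add_one_div_choose {x : ℂ} {j : ℕ} (h1 : x + 1 ≠ 0) (h2 : x + 2 ≠ 0)
    (hj : ∀ i ≤ j, x + 1 - i ≠ 0) :
    1 / ((x + 2) * Ring.choose (x + 1) j) + 1 / ((x + 2) * Ring.choose (x + 1) (j + 1))
      = 1 / ((x + 1) * Ring.choose x j) := by
  have hc : Ring.choose (x + 1) (j + 1) ≠ 0 :=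
    choose_ne_zero fun i hi => hj i (Nat.lt_succ_iff.1 hi)
  have hc' : Ring.choose (x + 1) j ≠ 0 := choose_ne_zero fun i hi => hj i hi.le
  have e1 := succ_mul_choose_succ_succ x j
  have e2 := sub_mul_choose_add_one x j
  have hjj : (j + 1 : ℂ) ≠ 0 := by exact_mod_cast j.succ_ne_zero
  have hcx : Ring.choose x j ≠ 0 := fun h => by
    rw [h, mul_zero] at e1; exact mul_ne_zero hjj hc e1
  have e1' : Ring.choose (x + 1) (j + 1) = (x + 1) * Ring.choose x j / (j + 1) := by
    field_simp; linear_combination e1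
  have e2' : Ring.choose (x + 1) j = (x + 1) * Ring.choose x j / (x + 1 - j) := by
    have := hj j le_rfl
    field_simp; linear_combination e2
  have := hj j le_rfl
  rw [e1', e2']
  field_simp
  ring

/-! ### The single-type sum -/

/-- The increment `n! / (b+1)_{n+1} * ∑_{i ≤ n} (n+a choose i) c ^ (i-n)` of the normalised double
sum. -/
noncomputable def increment (n : ℕ) (a b c : ℂ) : ℂ :=
  n.factorial / poch (b + 1) (n + 1) *
    ∑ i ∈ range (n + 1), Ring.choose ((n : ℂ) + a) i * c ^ ((i : ℤ) - (n : ℤ))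

theorem increment_eq {n : ℕ} {a b c : ℂ} (hb : ¬ IsNegInt b) :
    increment n a b c = 1 / (b + 1) * ∑ j ∈ range (n + 1),
      Ring.choose ((n : ℂ) + a) j / Ring.choose ((n : ℂ) + b + 1) n * c ^ ((j : ℤ) - (n : ℤ)) := by
  have h := add_one_add_natCast_ne_zero hb
  have hf : (n.factorial : ℂ) ≠ 0 := by exact_mod_cast n.factorial_ne_zero
  have hb1 : b + 1 ≠ 0 := by simpa using h 0
  have hp : poch (b + 1 + 1) n ≠ 0 := poch_ne_zero (fun k => by
    have := h (k + 1); push_cast at this; rwa [add_assoc _ 1, add_comm 1 (k : ℂ)]) n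
  have hc : Ring.choose ((n : ℂ) + b + 1) n = poch (b + 1 + 1) n / n.factorial := by
    rw [← factorial_mul_choose, ← add_assoc]; field_simp
  rw [increment, poch_succ_left, hc, mul_sum, mul_sum]
  refine sum_congr rfl fun i _ => ?_
  field_simp

theorem one_div_mul_choose_self {n : ℕ} {b : ℂ} :
    1 / (((n : ℂ) + b + 1) * Ring.choose ((n : ℂ) + b) n)
      = n.factorial / poch (b + 1) (n + 1) := by
  have hf : (n.factorial : ℂ) ≠ 0 := by exact_mod_cast n.factorial_ne_zero
  rw [poch_succ, ← factorial_mul_choose, show b + 1 + (n : ℂ) = n + b + 1 by ring, mul_assoc,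
    div_mul_cancel_left₀ hf, one_div, mul_comm]

theorem normalised_doubleSum_succ (n : ℕ) {a b c : ℂ} (hb : ¬ IsNegInt b) :
    1 / (((n + 1 : ℕ) : ℂ) + b + 1) * doubleSum (n + 1) a b c
      = 1 / ((n : ℂ) + b + 1) * doubleSum n a b c + increment (n + 1) a b c := by
  have h := add_one_add_natCast_ne_zero hb
  -- `A j` is an inner sum for `n`; by Pascal's rule the inner sums for `n + 1` are `A (j + 1) + A j`
  set f : ℕ → ℕ → ℂ := fun j i => Ring.choose ((n : ℂ) + a + 1) i * c ^ ((i : ℤ) - (j : ℤ)) with hf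
  set A : ℕ → ℂ := fun j => ∑ i ∈ range (j + 1), f j i with hA
  set w : ℕ → ℂ := fun j => 1 / (((n : ℂ) + b + 2) * Ring.choose ((n : ℂ) + b + 1) j) with hw
  have hpascal : ∀ j : ℕ, ∑ i ∈ range (j + 1 + 1),
      Ring.choose ((n : ℂ) + a + 1 + 1) i * c ^ ((i : ℤ) - ((j + 1 : ℕ) : ℤ))
        = A (j + 1) + A j := fun j => by
    simp only [hA, hf]
    rw [sum_range_succ' _ (j + 1), sum_range_succ' _ (j + 1)]
    simp only [Ring.choose_succ_succ, add_mul, sum_add_distrib, Ring.choose_zero_right]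
    have : ∀ i : ℕ, (((i + 1 : ℕ) : ℤ) - ((j + 1 : ℕ) : ℤ)) = (i : ℤ) - j := fun i => by
      push_cast; ring
    simp only [this]
    ring
  have hL : 1 / (((n + 1 : ℕ) : ℂ) + b + 1) * doubleSum (n + 1) a b c
      = ∑ j ∈ range (n + 1), w (j + 1) * (A (j + 1) + A j) + w 0 * A 0 := by
    rw [doubleSum, mul_sum, sum_range_succ' _ (n + 1)]
    congr 1
    · refine sum_congr rfl fun j _ => ?_
      rw [← hpascal, mul_sum, mul_sum]
      refine sum_congr rfl fun i _ => ?_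
      simp only [hw]
      rw [show (((n + 1 : ℕ) : ℂ) + b + 1) = n + b + 2 by push_cast; ring,
        show (((n + 1 : ℕ) : ℂ) + b) = n + b + 1 by push_cast; ring,
        show (((n + 1 : ℕ) : ℂ) + a + 1) = n + a + 1 + 1 by push_cast; ring]
      field_simp
    · simp [hw, hA, hf]
      ring
  have hR : 1 / ((n : ℂ) + b + 1) * doubleSum n a b c
      = ∑ j ∈ range (n + 1), (w j + w (j + 1)) * A j := by
    rw [doubleSum, mul_sum]
    refine sum_congr rfl fun j hj => ?_
    have hne : ∀ i ≤ j, (n : ℂ) + b + 1 - i ≠ 0 := fun i hi => by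
      have hin : i ≤ n := hi.trans (Nat.lt_succ_iff.1 (mem_range.1 hj))
      have := h (n - i)
      rw [Nat.cast_sub hin] at this
      convert this using 1; ring
    simp only [hw]
    rw [one_div_choose_add_one_div_choose (by simpa using hne 0 (Nat.zero_le j)) (by
        have := h (n + 1); push_cast at this; convert this using 1; ring) hne, hA, mul_sum, mul_sum]
    refine sum_congr rfl fun i _ => ?_
    simp only [hf]
    field_simp
  have hI : increment (n + 1) a b c = w (n + 1) * A (n + 1) := by
    rw [increment, ← one_div_mul_choose_self]
    simp only [hw, hA, hf]
    rw [show (((n + 1 : ℕ) : ℂ) + b + 1) = n + b + 2 by push_cast; ring,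
        show (((n + 1 : ℕ) : ℂ) + b) = n + b + 1 by push_cast; ring,
        show (((n + 1 : ℕ) : ℂ) + a) = n + a + 1 by push_cast; ring]
  have hshift := (sum_range_succ' (fun j => w j * A j) (n + 1)).symm.trans
    (sum_range_succ (fun j => w j * A j) (n + 1))
  rw [hL, hR, hI]
  simp only [mul_add, add_mul, sum_add_distrib]
  linear_combination hshift

theorem normalised_doubleSum_eq (n : ℕ) {a b c : ℂ} (hb : ¬ IsNegInt b) :
    1 / ((n : ℂ) + b + 1) * doubleSum n a b c = ∑ m ∈ range (n + 1), increment m a b c := by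
  induction n with
  | zero => simp [doubleSum, increment, poch_succ, poch_zero]
  | succ n ih => rw [normalised_doubleSum_succ n hb, ih, sum_range_succ _ (n + 1)]

/-- Pascal's rule, summed: raising `a` by one multiplies the increment by `1 + c`, up to a
boundary term. -/
theorem increment_add_one {n : ℕ} {a b c : ℂ} (hc : c ≠ 0) :
    increment n (a + 1) b c
      = (c + 1) * increment n a b c - c * (poch (a + 1) n / poch (b + 1) (n + 1)) := by
  have key : ∑ i ∈ range (n + 1), Ring.choose ((n : ℂ) + a + 1) i * c ^ ((i : ℤ) - (n : ℤ))
      = (c + 1) * ∑ i ∈ range (n + 1), Ring.choose ((n : ℂ) + a) i * c ^ ((i : ℤ) - (n : ℤ))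
        - c * Ring.choose ((n : ℂ) + a) n := by
    rw [sum_range_succ' _ n]
    simp only [Ring.choose_succ_succ, add_mul, sum_add_distrib, Ring.choose_zero_right]
    have e1 := sum_range_succ' (fun i => Ring.choose ((n : ℂ) + a) i * c ^ ((i : ℤ) - (n : ℤ))) n
    have e2 : ∑ i ∈ range n, Ring.choose ((n : ℂ) + a) i * c ^ (((i + 1 : ℕ) : ℤ) - (n : ℤ))
        = c * ∑ i ∈ range n, Ring.choose ((n : ℂ) + a) i * c ^ ((i : ℤ) - (n : ℤ)) := by
      rw [mul_sum]
      refine sum_congr rfl fun i _ => ?_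
      rw [show ((i + 1 : ℕ) : ℤ) - (n : ℤ) = ((i : ℤ) - n) + 1 by push_cast; ring,
        zpow_add_one₀ hc]
      ring
    have e3 := sum_range_succ (fun i => Ring.choose ((n : ℂ) + a) i * c ^ ((i : ℤ) - (n : ℤ))) n
    simp only [sub_self, zpow_zero, mul_one, Ring.choose_zero_right] at e1 e3
    rw [e2]
    linear_combination c * e3.symm - e1
  rw [increment, increment, ← add_assoc, key, ← factorial_mul_choose a]
  ring

/-- A telescoping sum; it is used with `x = a + k` and with `x = b - l`. -/
theorem poch_div_poch (n : ℕ) {x b : ℂ} (hb : ¬ IsNegInt b) :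
    poch (x + 1) n / poch (b + 1) n
      = 1 + (x - b) * ∑ m ∈ range n, poch (x + 1) m / poch (b + 1) (m + 1) := by
  induction n with
  | zero => simp [poch_zero]
  | succ n ih =>
    rw [sum_range_succ, mul_add, ← add_assoc, ← ih, poch_succ, poch_succ]
    have h1 := add_one_add_natCast_ne_zero hb n
    have h2 := poch_ne_zero (add_one_add_natCast_ne_zero hb) n
    field_simp
    ring

theorem hasSum_choose_natCast_mul_pow (m : ℕ) {z : ℂ} (hz : ‖z‖ < 1) :
    HasSum (fun k : ℕ => Ring.choose (k : ℂ) m * z ^ k) (z ^ m * (1 / (1 - z) ^ (m + 1))) := by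
  have h := (hasSum_choose_mul_geometric_of_norm_lt_one m hz).mul_left (z ^ m)
  rw [← hasSum_nat_add_iff' m, sum_eq_zero, sub_zero]
  · convert! h using 1
    ext k
    rw [Ring.choose_natCast]; ring
  · intro i hi
    rw [Ring.choose_natCast, Nat.choose_eq_zero_of_lt (mem_range.1 hi)]; simp

/-- The generating function of `(a+1+k)_m`, by Vandermonde's identity. -/
theorem hasSum_poch_mul_pow (m : ℕ) (a : ℂ) {z : ℂ} (hz : ‖z‖ < 1) :
    HasSum (fun k : ℕ => poch (a + k + 1) m * z ^ k)
      (m.factorial * ∑ i ∈ range (m + 1),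
        Ring.choose ((m : ℂ) + a) i * (z ^ (m - i) * (1 / (1 - z) ^ (m - i + 1)))) := by
  have h := (hasSum_sum fun i (_ : i ∈ range (m + 1)) =>
    (hasSum_choose_natCast_mul_pow (m - i) hz).mul_left (Ring.choose ((m : ℂ) + a) i)).mul_left
      (m.factorial : ℂ)
  convert! h using 1
  ext k
  rw [← factorial_mul_choose, ← add_assoc, Ring.add_choose_eq m (Commute.all _ _),
    Finset.Nat.sum_antidiagonal_eq_sum_range_succ_mk, mul_assoc, sum_mul]
  simp only [mul_assoc]

/-! ### The hypergeometric functions -/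

theorem isPrincipalBranch_hyp2F1_of_exists {a b c : ℂ}
    (h : ∃ F, IsPrincipalBranch (coeff2F1 a b c) F) :
    IsPrincipalBranch (coeff2F1 a b c) (hyp2F1 a b c) := Classical.epsilon_spec h

theorem isPrincipalBranch_hyp3F2_of_exists {a b c d e : ℂ}
    (h : ∃ F, IsPrincipalBranch (coeff3F2 a b c d e) F) :
    IsPrincipalBranch (coeff3F2 a b c d e) (hyp3F2 a b c d e) := Classical.epsilon_spec h

theorem coeff2F1_one (s : ℂ) (k : ℕ) : coeff2F1 1 s (s + 1) k = poch s k / poch (s + 1) k := by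
  have hf : (k.factorial : ℂ) ≠ 0 := by exact_mod_cast k.factorial_ne_zero
  rw [coeff2F1, poch_one]
  field_simp

theorem add_mul_coeff2F1_one {s : ℂ} (hs : ¬ IsNegInt s) (k : ℕ) :
    (s + k) * coeff2F1 1 s (s + 1) k = s := by
  have h := poch_ne_zero (add_one_add_natCast_ne_zero hs) k
  have h2 := poch_succ s k
  rw [poch_succ_left] at h2
  rw [coeff2F1_one]
  field_simp
  linear_combination -h2

theorem isPrincipalBranch_hyp2F1 {s : ℂ} (hs : ¬ IsNegInt s) :
    IsPrincipalBranch (coeff2F1 1 s (s + 1)) (hyp2F1 1 s (s + 1)) := by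
  apply isPrincipalBranch_hyp2F1_of_exists
  have hcoeff := add_mul_coeff2F1_one hs
  by_cases h0 : s = 0
  -- for `s = 0` the coefficients are not `s / (s + k)` at `k = 0`: the series is the constant `1`
  · apply exists_isPrincipalBranch_of_succ
    have hz : ∀ k : ℕ, coeff2F1 1 s (s + 1) (k + 1) = 0 := fun k => by
      have := hcoeff (k + 1)
      rw [h0, zero_add, mul_eq_zero] at this
      exact h0 ▸ (this.resolve_left (by exact_mod_cast k.succ_ne_zero))
    have h := IsCutHolomorphic.const 0
    refine ⟨fun _ => 0, fun z _ => ?_, h.1, h.2⟩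
    simp only [hz, zero_mul]
    exact hasSum_zero
  · obtain ⟨F, hF⟩ := exists_isPrincipalBranch_one_div_add s
    have h := (IsCutHolomorphic.const s).mul hF.isCutHolomorphic
    refine ⟨_, fun z hz => ?_, h.1, h.2⟩
    convert! (hF.hasSum z hz).mul_left s using 1
    ext k
    have hk : s + k ≠ 0 := fun h => h0 (by rw [← hcoeff k, h, zero_mul])
    rw [← mul_assoc]
    congr 1
    field_simp
    linear_combination hcoeff k

/-- The rational function of `z` with power series coefficients
`∑_{m ≤ n} (a+1+k)_m / (b+1)_{m+1}`. -/
noncomputable def rationalPart (n : ℕ) (a b z : ℂ) : ℂ :=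
  ∑ m ∈ range (n + 1), 1 / poch (b + 1) (m + 1) * (m.factorial * ∑ i ∈ range (m + 1),
    Ring.choose ((m : ℂ) + a) i * (z ^ (m - i) * (1 / (1 - z) ^ (m - i + 1))))

theorem hasSum_rationalPart (n : ℕ) (a b : ℂ) {z : ℂ} (hz : ‖z‖ < 1) :
    HasSum (fun k : ℕ => (∑ m ∈ range (n + 1), poch (a + k + 1) m / poch (b + 1) (m + 1)) * z ^ k)
      (rationalPart n a b z) := by
  have h := hasSum_sum fun m (_ : m ∈ range (n + 1)) =>
    (hasSum_poch_mul_pow m a hz).mul_left (1 / poch (b + 1) (m + 1))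
  convert! h using 1
  ext k
  rw [sum_mul]
  exact sum_congr rfl fun m _ => by ring

theorem isCutHolomorphic_rationalPart (n : ℕ) (a b : ℂ) :
    IsCutHolomorphic (rationalPart n a b) := by
  apply IsCutHolomorphic.of_differentiableOn
  intro z hz
  have h1 : 1 - z ≠ 0 := sub_ne_zero.2 fun h => hz h.symm
  unfold rationalPart
  refine DifferentiableAt.differentiableWithinAt ?_
  fun_prop (disch := exact pow_ne_zero _ h1)

theorem rationalPart_one_div (n : ℕ) (a b : ℂ) {c : ℂ} (h0 : c ≠ 0) (h1 : c + 1 ≠ 0) :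
    rationalPart n a b (1 / (c + 1)) = (c + 1) / c * ∑ m ∈ range (n + 1), increment m a b c := by
  rw [rationalPart, mul_sum]
  refine sum_congr rfl fun m _ => ?_
  have : ∀ i ∈ range (m + 1), Ring.choose ((m : ℂ) + a) i *
      ((1 / (c + 1)) ^ (m - i) * (1 / (1 - 1 / (c + 1)) ^ (m - i + 1)))
      = (c + 1) / c * (Ring.choose ((m : ℂ) + a) i * c ^ ((i : ℤ) - (m : ℤ))) := fun i hi => by
    have hi' : i ≤ m := Nat.lt_succ_iff.1 (Finset.mem_range.1 hi)
    have e : (i : ℤ) - (m : ℤ) = -((m - i : ℕ) : ℤ) := by push_cast [hi']; ring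
    have e2 : 1 - 1 / (c + 1) = c / (c + 1) := by field_simp; ring
    rw [e, e2, zpow_neg, zpow_natCast, div_pow, div_pow, one_pow, pow_succ, pow_succ]
    field_simp
  rw [sum_congr rfl this, increment, ← mul_sum]
  ring

/-- Partial fractions in `k` for the coefficients of `₃F₂(1, s, n+a+2; s+1, a+1; z)`. -/
theorem coeff3F2_eq (n : ℕ) {a b s : ℂ} (hs : s = a - b) (ha : ¬ IsNegInt a) (hb : ¬ IsNegInt b)
    (hs' : ¬ IsNegInt s) (k : ℕ) :
    coeff3F2 1 s ((n : ℂ) + a + 2) (s + 1) (a + 1) k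
      = poch (b + 1) (n + 1) / poch (a + 1) (n + 1) * (coeff2F1 1 s (s + 1) k
        + s * ∑ m ∈ range (n + 1), poch (a + k + 1) m / poch (b + 1) (m + 1)) := by
  have hf : (k.factorial : ℂ) ≠ 0 := by exact_mod_cast k.factorial_ne_zero
  have hA := poch_ne_zero (add_one_add_natCast_ne_zero ha)
  have hB := poch_ne_zero (add_one_add_natCast_ne_zero hb) (n + 1)
  have hS := poch_ne_zero (add_one_add_natCast_ne_zero hs') k
  have e1 := poch_add (a + 1) (n + 1) k
  rw [add_comm (n + 1) k, poch_add (a + 1) k (n + 1)] at e1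
  have e2 := poch_div_poch (n + 1) (x := a + k) hb
  have e3 : a + k - b = s + k := by rw [hs]; ring
  rw [e3] at e2
  have e4 : poch (a + k + 1) (n + 1) = poch (b + 1) (n + 1) *
      (1 + (s + k) * ∑ m ∈ range (n + 1), poch (a + k + 1) m / poch (b + 1) (m + 1)) := by
    rw [← e2]; field_simp
  rw [show a + 1 + (k : ℂ) = a + k + 1 by ring,
    show a + 1 + ((n + 1 : ℕ) : ℂ) = n + a + 2 by push_cast; ring] at e1
  have hc := add_mul_coeff2F1_one hs' k
  have h3 : coeff3F2 1 s ((n : ℂ) + a + 2) (s + 1) (a + 1) k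
      = coeff2F1 1 s (s + 1) k * (poch (a + k + 1) (n + 1) / poch (a + 1) (n + 1)) := by
    have h1 := hA k
    have h2 := hA (n + 1)
    rw [coeff2F1_one, coeff3F2, poch_one]
    field_simp
    linear_combination -poch s k * e1
  rw [h3, e4]
  generalize ∑ m ∈ range (n + 1), poch (a + k + 1) m / poch (b + 1) (m + 1) = T at *
  have h2 := hA (n + 1)
  field_simp
  linear_combination T * hc

theorem isPrincipalBranch_coeff3F2 (n : ℕ) {a b s : ℂ} (hs : s = a - b) (ha : ¬ IsNegInt a)
    (hb : ¬ IsNegInt b) (hs' : ¬ IsNegInt s) :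
    IsPrincipalBranch (coeff3F2 1 s ((n : ℂ) + a + 2) (s + 1) (a + 1))
      (fun z => poch (b + 1) (n + 1) / poch (a + 1) (n + 1)
        * (hyp2F1 1 s (s + 1) z + s * rationalPart n a b z)) := by
  have hF := isPrincipalBranch_hyp2F1 hs'
  have h := (IsCutHolomorphic.const (poch (b + 1) (n + 1) / poch (a + 1) (n + 1))).mul
    (hF.isCutHolomorphic.add ((IsCutHolomorphic.const s).mul (isCutHolomorphic_rationalPart n a b)))
  refine ⟨fun z hz => ?_, h.1, h.2⟩
  convert! ((hF.hasSum z hz).add ((hasSum_rationalPart n a b hz).mul_left s)).mul_left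
    (poch (b + 1) (n + 1) / poch (a + 1) (n + 1)) using 1
  ext k
  rw [coeff3F2_eq n hs ha hb hs']
  ring

theorem isPrincipalBranch_hyp3F2 (n : ℕ) {a b s : ℂ} (hs : s = a - b) (ha : ¬ IsNegInt a)
    (hb : ¬ IsNegInt b) (hs' : ¬ IsNegInt s) :
    IsPrincipalBranch (coeff3F2 1 s ((n : ℂ) + a + 2) (s + 1) (a + 1))
      (hyp3F2 1 s ((n : ℂ) + a + 2) (s + 1) (a + 1)) :=
  isPrincipalBranch_hyp3F2_of_exists ⟨_, isPrincipalBranch_coeff3F2 n hs ha hb hs'⟩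

theorem hyp3F2_one_div_eq (n : ℕ) {a b c s : ℂ} (hs : s = a - b) (ha : ¬ IsNegInt a)
    (hb : ¬ IsNegInt b) (hs' : ¬ IsNegInt s) (h0 : c ≠ 0) (h1 : c + 1 ≠ 0) :
    hyp3F2 1 s ((n : ℂ) + a + 2) (s + 1) (a + 1) (1 / (c + 1))
      = poch (b + 1) (n + 1) / poch (a + 1) (n + 1) * (hyp2F1 1 s (s + 1) (1 / (c + 1))
        + s * ((c + 1) / c * ∑ m ∈ range (n + 1), increment m a b c)) := by
  have hz : 1 / (c + 1) ≠ 1 := by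
    rw [Ne, div_eq_one_iff_eq h1]; intro h; exact h0 (by linear_combination -h)
  rw [(isPrincipalBranch_hyp3F2 n hs ha hb hs').eq (isPrincipalBranch_coeff3F2 n hs ha hb hs') hz,
    rationalPart_one_div n a b h0 h1]

/-! ### Gamma quotients and the digamma function -/

/-- The hypothesis keeps `x + n` away from the poles; at a pole `x` of `Γ` both sides vanish. -/
theorem Gamma_add_div_Gamma {x : ℂ} (n : ℕ) (h : ∀ k : ℕ, x + n + k ≠ 0) :
    Gamma (x + n) / Gamma x = poch x n := by
  induction n generalizing x with
  | zero =>
    have := Gamma_ne_zero (s := x) fun m hm => h m (by rw [hm]; simp)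
    simp only [Nat.cast_zero, add_zero, poch_zero]
    exact div_self this
  | succ n ih =>
    have hr := ih (x := x + 1) fun k => by
      have := h k; push_cast at this; rwa [add_assoc x 1, add_comm 1 (n : ℂ)]
    rw [poch_succ_left, ← hr]
    by_cases hx : x = 0
    · simp [hx]
    · rw [Gamma_add_one x hx, show x + 1 + (n : ℂ) = x + (n + 1 : ℕ) by push_cast; ring]
      field_simp

theorem gammaBinom_eq (n : ℕ) {x : ℂ} (hx : ¬ IsNegInt x) :
    gammaBinom ((n : ℂ) + x + 1) x = poch (x + 1) (n + 1) / (n + 1).factorial := by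
  have h := add_one_add_natCast_ne_zero hx
  rw [gammaBinom, ← Gamma_add_div_Gamma (n + 1) (fun k => by
      have := h (n + 1 + k); push_cast at this ⊢; rwa [add_assoc]),
    show (n : ℂ) + x + 1 - x + 1 = (n + 1 : ℕ) + 1 by push_cast; ring, Gamma_nat_eq_factorial,
    show (n : ℂ) + x + 1 + 1 = x + 1 + (n + 1 : ℕ) by push_cast; ring, div_div]

theorem digamma_add_sub_digamma (n : ℕ) {x : ℂ} (h : ∀ k : ℕ, x + k ≠ 0) :
    digamma (x + n) - digamma x = ∑ k ∈ range n, 1 / (x + k) := by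
  induction n with
  | zero => simp
  | succ n ih =>
    rw [sum_range_succ, ← ih, Nat.cast_succ, ← add_assoc, digamma_apply_add_one, one_div]
    · ring
    · intro m hm
      apply h (n + m)
      push_cast
      rw [← add_assoc, hm]; ring

theorem not_isNegInt_one : ¬ IsNegInt 1 := fun h => by
  obtain ⟨k, hk⟩ := isNegInt_iff.1 h
  have : ((1 + 1 + k : ℕ) : ℂ) = 0 := by push_cast; linear_combination hk
  exact absurd (Nat.cast_eq_zero.1 this) (by omega)

theorem not_isNegInt_add_one {x : ℂ} (hx : ¬ IsNegInt x) : ¬ IsNegInt (x + 1) := fun h => by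
  obtain ⟨k, hk⟩ := isNegInt_iff.1 h
  exact hx (isNegInt_iff.2 ⟨k + 1, by push_cast; linear_combination hk⟩)

theorem isPrincipalBranch_neg_log :
    IsPrincipalBranch (fun k => 1 / (k : ℂ)) fun z => -log (1 - z) where
  hasSum z hz := by
    simpa [div_eq_inv_mul] using hasSum_taylorSeries_neg_log hz
  differentiableOn z hz :=
    (((differentiableAt_const 1).sub differentiableAt_id).clog hz).neg.differentiableWithinAt
  tendsto_below x hx := by
    have h := continuousWithinAt_log_of_re_neg_of_im_zero (z := 1 - x) (by simpa using hx) (by simp)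
    refine (h.tendsto.comp (tendsto_nhdsWithin_of_tendsto_nhds_of_eventually_within _
      ((continuous_const.sub continuous_id).continuousAt.tendsto.mono_left nhdsWithin_le_nhds)
      ?_)).neg
    filter_upwards [self_mem_nhdsWithin] with z hz
    have : z.im < 0 := hz
    simp [this.le]

theorem mul_hyp2F1_one_one {z : ℂ} (hz : z ≠ 1) : z * hyp2F1 1 1 (1 + 1) z = -log (1 - z) := by
  have h1 := not_isNegInt_one
  have hF := isPrincipalBranch_hyp2F1 h1
  have h := (IsCutHolomorphic.of_differentiableOn differentiableOn_id).mul hF.isCutHolomorphic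
  refine IsPrincipalBranch.eq (F := fun z => z * hyp2F1 1 1 (1 + 1) z) ⟨fun z hz => ?_, h.1, h.2⟩
    isPrincipalBranch_neg_log hz
  rw [← hasSum_nat_add_iff' 1]
  convert! (hF.hasSum z hz).mul_left z using 1
  · ext k
    have hk : (k + 1 : ℂ) ≠ 0 := by exact_mod_cast k.succ_ne_zero
    have := add_mul_coeff2F1_one h1 k
    have e : coeff2F1 1 1 (1 + 1) k = 1 / (k + 1) := by
      field_simp; linear_combination this
    rw [e]; push_cast; ring
  · simp

/-! ### Evaluation of the closed forms -/

theorem closedForm_eq (n : ℕ) {a b c : ℂ} (ha : ¬ IsNegInt a) (hb : ¬ IsNegInt b)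
    (hab : ¬ IsNegInt (a - b)) (h0 : c ≠ 0) (h1 : c + 1 ≠ 0) :
    closedForm n a b c = (a - b) * ((c + 1) / c * ∑ m ∈ range (n + 1), increment m a b c) := by
  have hA := poch_ne_zero (add_one_add_natCast_ne_zero ha) (n + 1)
  have hB := poch_ne_zero (add_one_add_natCast_ne_zero hb) (n + 1)
  have hf : ((n + 1).factorial : ℂ) ≠ 0 := by exact_mod_cast (n + 1).factorial_ne_zero
  rw [closedForm, hyp3F2_one_div_eq n rfl ha hb hab h0 h1, gammaBinom_eq n ha, gammaBinom_eq n hb]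
  generalize (c + 1) / c * ∑ m ∈ range (n + 1), increment m a b c = T
  field_simp
  ring

theorem increment_add_one_eq (n m : ℕ) {b c : ℂ} (hc : c ≠ 0) :
    increment n (b + 1) b c = (c + 1) ^ (m + 1) * increment n (b - m) b c
      - c * ∑ l ∈ range (m + 1), (c + 1) ^ l * (poch (b - l + 1) n / poch (b + 1) (n + 1)) := by
  induction m with
  | zero => simp [increment_add_one hc]
  | succ m ih =>
    have h := increment_add_one (n := n) (a := b - (m + 1 : ℕ)) (b := b) hc
    rw [show b - ((m + 1 : ℕ) : ℂ) + 1 = b - m by push_cast; ring] at h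
    rw [ih, h, sum_range_succ _ (m + 1), show b - ((m + 1 : ℕ) : ℂ) + 1 = b - m by push_cast; ring]
    ring

theorem sum_increment_add_one_eq (n m : ℕ) {b c : ℂ} (hb : ¬ IsNegInt b) (hc : c ≠ 0) :
    ∑ k ∈ range (n + 1), increment k (b + 1) b c
      = (c + 1) ^ (m + 1) * ∑ k ∈ range (n + 1), increment k (b - m) b c
        - c * (∑ k ∈ range (n + 1), 1 / (b + 1 + k) - ∑ l ∈ Finset.Icc 1 m, (c + 1) ^ l / (l : ℂ)
          * (poch (b + 1 - l) (n + 1) / poch (b + 1) (n + 1) - 1)) := by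
  have h := add_one_add_natCast_ne_zero hb
  have hl : ∀ l : ℕ, ∑ k ∈ range (n + 1), (c + 1) ^ (l + 1)
      * (poch (b - ((l + 1 : ℕ) : ℂ) + 1) k / poch (b + 1) (k + 1))
      = -((c + 1) ^ (l + 1) / ((l + 1 : ℕ) : ℂ)
          * (poch (b + 1 - ((l + 1 : ℕ) : ℂ)) (n + 1) / poch (b + 1) (n + 1) - 1)) := fun l => by
    have hl0 : ((l + 1 : ℕ) : ℂ) ≠ 0 := by exact_mod_cast l.succ_ne_zero
    rw [show b + 1 - ((l + 1 : ℕ) : ℂ) = b - ((l + 1 : ℕ) : ℂ) + 1 by ring,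
      poch_div_poch (n + 1) hb, ← mul_sum]
    field_simp
    ring
  have h0 : ∀ k : ℕ, (c + 1) ^ 0 * (poch (b - ((0 : ℕ) : ℂ) + 1) k / poch (b + 1) (k + 1))
      = 1 / (b + 1 + k) := fun k => by
    have h1 := poch_ne_zero h k
    rw [poch_succ, Nat.cast_zero, sub_zero]
    field_simp
  have hIcc : ∀ f : ℕ → ℂ, ∑ l ∈ Finset.Icc 1 m, f l = ∑ l ∈ range m, f (l + 1) := fun f => by
    rw [← Finset.Ico_add_one_right_eq_Icc, sum_Ico_eq_sum_range]
    simp only [add_comm 1, Nat.add_sub_cancel]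
  simp only [increment_add_one_eq _ m hc, sum_sub_distrib, ← mul_sum (range (n + 1))]
  rw [sum_comm, sum_range_succ' _ m, hIcc]
  simp only [hl, h0, sum_neg_distrib]
  ring

/-- The first term of the closed form is `-log (c / (c + 1))` plus a multiple of the increments for
`a = b + 1`; the logarithms cancel. -/
theorem closedFormInt_eq (n m : ℕ) {b c : ℂ} (hb : ¬ IsNegInt b)
    (hn : ¬ IsNegInt ((n : ℂ) + (b - m) + 1)) (h0 : c ≠ 0) (h1 : c + 1 ≠ 0) :
    closedFormInt n m b c
      = (c + 1) ^ (m + 1) / c * ∑ k ∈ range (n + 1), increment k (b - m) b c := by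
  have h := add_one_add_natCast_ne_zero hb
  have hb1 : ¬ IsNegInt (b + 1) := not_isNegInt_add_one hb
  have hH : hyp3F2 1 1 ((n : ℂ) + b + 3) 2 (b + 2) (1 / (c + 1))
      = poch (b + 1) (n + 1) / poch (b + 1 + 1) (n + 1) * (hyp2F1 1 1 (1 + 1) (1 / (c + 1))
        + 1 * ((c + 1) / c * ∑ k ∈ range (n + 1), increment k (b + 1) b c)) := by
    rw [← hyp3F2_one_div_eq n (s := 1) (by ring) hb1 hb not_isNegInt_one h0 h1,
      show (n : ℂ) + (b + 1) + 2 = n + b + 3 by ring, show b + 1 + 1 = b + 2 by ring,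
      one_add_one_eq_two]
  have hlog := mul_hyp2F1_one_one (z := 1 / (c + 1)) (by
    rw [Ne, div_eq_one_iff_eq h1]; intro h; exact h0 (by linear_combination -h))
  rw [show 1 - 1 / (c + 1) = c / (c + 1) by field_simp; ring] at hlog
  have hpsi := digamma_add_sub_digamma (n + 1) h
  rw [show b + 1 + ((n + 1 : ℕ) : ℂ) = n + b + 2 by push_cast; ring] at hpsi
  have hG : ∀ l ∈ Finset.Icc 1 m, (c + 1) ^ l / (l : ℂ)
        * (Gamma ((n : ℂ) + b + 2 - l) * Gamma (b + 1)
            / (Gamma ((n : ℂ) + b + 2) * Gamma (b + 1 - l)) - 1)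
      = (c + 1) ^ l / (l : ℂ)
        * (poch (b + 1 - l) (n + 1) / poch (b + 1) (n + 1) - 1) := fun l hl => by
    have hlm := (Finset.mem_Icc.1 hl).2
    rw [← Gamma_add_div_Gamma (x := b + 1) (n + 1) fun k => by
        have := h (n + 1 + k); push_cast at this ⊢; rwa [add_assoc],
      ← Gamma_add_div_Gamma (x := b + 1 - l) (n + 1) fun k => by
        have := add_one_add_natCast_ne_zero hn (m - l + k)
        push_cast [hlm] at this ⊢
        convert this using 1; ring,
      show b + 1 + ((n + 1 : ℕ) : ℂ) = n + b + 2 by push_cast; ring,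
      show b + 1 - l + ((n + 1 : ℕ) : ℂ) = n + b + 2 - l by push_cast; ring]
    congr 2
    rw [div_div_div_eq, mul_comm (Gamma (b + 1 - l))]
  have hA := poch_ne_zero h (n + 1)
  have hB := poch_ne_zero (add_one_add_natCast_ne_zero hb1) (n + 1)
  have hb0 : b + 1 ≠ 0 := by simpa using h 0
  have hρ : ((n : ℂ) + b + 2) / ((b + 1) * (c + 1))
      * (poch (b + 1) (n + 1) / poch (b + 1 + 1) (n + 1)) = 1 / (c + 1) := by
    have e := poch_succ (b + 1) (n + 1)
    rw [poch_succ_left, show b + 1 + ((n + 1 : ℕ) : ℂ) = n + b + 2 by push_cast; ring] at e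
    field_simp
    linear_combination -e
  rw [closedFormInt, hH, sum_congr rfl hG, ← mul_assoc, hρ, sum_increment_add_one_eq n m hb h0]
  generalize ∑ l ∈ Finset.Icc 1 m, (c + 1) ^ l / (l : ℂ)
        * (poch (b + 1 - l) (n + 1) / poch (b + 1) (n + 1) - 1) = E
  rw [mul_add, hlog, one_mul, add_sub_assoc _ (digamma _), hpsi]
  field_simp
  ring

/-! ### Passage to the limit -/

theorem eventually_not_isNegInt (w : ℂ) : ∀ᶠ z in 𝓝[≠] w, ¬ IsNegInt z := by
  have hcl : IsClosed {z : ℂ | IsNegInt z ∧ z ≠ w} := by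
    have : {z : ℂ | IsNegInt z ∧ z ≠ w}
        = (fun k : ℤ => ((k : ℝ) : ℂ)) '' {k : ℤ | k < 0 ∧ (k : ℂ) ≠ w} := by
      ext z
      constructor
      · rintro ⟨⟨k, rfl⟩, hw⟩
        refine ⟨-((k : ℤ) + 1), ⟨by omega, by push_cast; exact hw⟩, by push_cast; ring⟩
      · rintro ⟨k, ⟨hk, hw⟩, rfl⟩
        refine ⟨⟨(-k - 1).toNat, ?_⟩, by simpa using hw⟩
        have e : (((-k - 1).toNat : ℤ) : ℂ) = ((-k - 1 : ℤ) : ℂ) := by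
          rw [Int.toNat_of_nonneg (by omega)]
        rw [Int.cast_natCast] at e
        rw [e]; push_cast; ring
    rw [this]
    exact (isometry_ofReal.isClosedEmbedding.comp Int.isClosedEmbedding_coe_real).isClosedMap _
      (isClosed_discrete _)
  filter_upwards [mem_nhdsWithin_of_mem_nhds (hcl.isOpen_compl.mem_nhds fun h => h.2 rfl),
    self_mem_nhdsWithin] with z hz hzw hneg
  exact hz ⟨hneg, hzw⟩

theorem eventually_not_isNegInt_add (w v : ℂ) : ∀ᶠ z in 𝓝[≠] w, ¬ IsNegInt (z + v) := by
  refine (tendsto_nhdsWithin_of_tendsto_nhds_of_eventually_within _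
    ((continuous_add_const v).continuousAt.tendsto.mono_left nhdsWithin_le_nhds) ?_).eventually
    (eventually_not_isNegInt (w + v))
  filter_upwards [self_mem_nhdsWithin] with z hz
  exact fun h => hz (add_right_cancel h)

theorem continuous_increment_left (n : ℕ) (b c : ℂ) : Continuous fun a => increment n a b c := by
  unfold increment
  exact continuous_const.mul (continuous_finsetSum _ fun i _ =>
    ((continuous_choose i).comp (continuous_const.add continuous_id)).mul continuous_const)

theorem continuousAt_increment_sub (n m : ℕ) {b : ℂ} (c : ℂ) (hb : ¬ IsNegInt b) :
    ContinuousAt (fun b' => increment n (b' - m) b' c) b := by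
  unfold increment
  refine ContinuousAt.mul (continuousAt_const.div ?_
    (poch_ne_zero (add_one_add_natCast_ne_zero hb) (n + 1))) (Continuous.continuousAt ?_)
  · exact ((continuous_poch (n + 1)).comp (continuous_id.add continuous_const)).continuousAt
  · exact continuous_finsetSum _ fun i _ => ((continuous_choose i).comp
      (continuous_const.add (continuous_id.sub continuous_const))).mul continuous_const

theorem theorem2 (n : ℕ) (a b c : ℂ) (hb : ¬ IsNegInt b) :
    -- reduction to the single-type sum
    (1 / ((n : ℂ) + b + 1) * doubleSum n a b c
      = 1 / (b + 1) * ∑ k ∈ Finset.range (n + 1), ∑ j ∈ Finset.range (k + 1),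
          Ring.choose ((k : ℂ) + a) j / Ring.choose ((k : ℂ) + b + 1) k
            * c ^ ((j : ℤ) - (k : ℤ)))
    ∧
    -- `a - b` is not a negative integer
    (¬ IsNegInt (a - b) → c ≠ -1 → c ≠ 0 →
      IsPrincipalBranch (coeff2F1 1 (a - b) (a - b + 1)) (hyp2F1 1 (a - b) (a - b + 1))
      ∧ (¬ IsNegInt a →
          IsPrincipalBranch (coeff3F2 1 (a - b) ((n : ℂ) + a + 2) (a - b + 1) (a + 1))
            (hyp3F2 1 (a - b) ((n : ℂ) + a + 2) (a - b + 1) (a + 1))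
          ∧ (a - b) * (c + 1) / (((n : ℂ) + b + 1) * c) * doubleSum n a b c
              = closedForm n a b c)
      -- if `a` is a negative integer, the closed form is read as a limit
      ∧ (IsNegInt a →
          Filter.Tendsto (fun a' : ℂ => closedForm n a' b c) (𝓝[≠] a)
            (𝓝 ((a - b) * (c + 1) / (((n : ℂ) + b + 1) * c) * doubleSum n a b c))))
    ∧
    -- `a - b = -m` is a negative integer or zero
    (∀ m : ℕ, a - b = -(m : ℂ) → c ≠ -1 → c ≠ 0 →
      IsPrincipalBranch (coeff3F2 1 1 ((n : ℂ) + b + 3) 2 (b + 2))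
        (hyp3F2 1 1 ((n : ℂ) + b + 3) 2 (b + 2))
      ∧ (¬ IsNegInt ((n : ℂ) + a + 1) →
          (c + 1) ^ (m + 1) / (((n : ℂ) + b + 1) * c) * doubleSum n a b c
            = closedFormInt n m b c)
      -- if `n + a + 1` is a negative integer, some of the quotients of Gamma values in the closed
      -- form are quotients of two poles, and the closed form is read as a limit
      ∧ (IsNegInt ((n : ℂ) + a + 1) →
          Filter.Tendsto (fun b' : ℂ => closedFormInt n m b' c) (𝓝[≠] b)
            (𝓝 ((c + 1) ^ (m + 1) / (((n : ℂ) + b + 1) * c) * doubleSum n a b c)))) := by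
  have hL := normalised_doubleSum_eq n (a := a) (c := c) hb
  have hscale : ∀ w : ℂ, w / (((n : ℂ) + b + 1) * c) * doubleSum n a b c
      = w / c * ∑ k ∈ range (n + 1), increment k a b c := fun w => by
    rw [← hL, mul_comm ((n : ℂ) + b + 1), ← div_div, div_eq_mul_one_div (w / c)]
    ring
  have hadd : c ≠ -1 → c + 1 ≠ 0 := fun h h' => h (eq_neg_of_add_eq_zero_left h')
  refine ⟨?_, fun hab hc1 hc0 => ⟨isPrincipalBranch_hyp2F1 hab, fun ha =>
    ⟨isPrincipalBranch_hyp3F2 n rfl ha hb hab, ?_⟩, fun ha => ?_⟩,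
    fun m hm hc1 hc0 => ⟨?_, fun hn => ?_, fun hn => ?_⟩⟩
  · rw [hL, mul_sum]
    exact sum_congr rfl fun k _ => increment_eq hb
  · rw [hscale, closedForm_eq n ha hb hab hc0 (hadd hc1), mul_div_assoc, mul_assoc]
  · rw [hscale, mul_div_assoc, mul_assoc]
    have hcont : Continuous fun a' : ℂ =>
        (a' - b) * ((c + 1) / c * ∑ k ∈ range (n + 1), increment k a' b c) :=
      (continuous_id.sub continuous_const).mul (continuous_const.mul
        (continuous_finsetSum _ fun k _ => continuous_increment_left k b c))
    refine (hcont.continuousAt.tendsto.mono_left nhdsWithin_le_nhds).congr' ?_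
    filter_upwards [eventually_not_isNegInt a, eventually_not_isNegInt_add a (-b)] with a' h1 h2
    exact (closedForm_eq n h1 hb h2 hc0 (hadd hc1)).symm
  · have h := isPrincipalBranch_hyp3F2 n (a := b + 1) (b := b) (s := 1) (by ring)
      (not_isNegInt_add_one hb) hb not_isNegInt_one
    rwa [show (n : ℂ) + (b + 1) + 2 = n + b + 3 by ring, show b + 1 + 1 = b + 2 by ring,
      one_add_one_eq_two] at h
  · obtain rfl : a = b - m := by linear_combination hm
    rw [hscale, closedFormInt_eq n m hb hn hc0 (hadd hc1)]
  · obtain rfl : a = b - m := by linear_combination hm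
    rw [hscale]
    have hcont : ContinuousAt (fun b' : ℂ =>
        (c + 1) ^ (m + 1) / c * ∑ k ∈ range (n + 1), increment k (b' - m) b' c) b :=
      continuousAt_const.mul (tendsto_finsetSum _ fun k _ => continuousAt_increment_sub k m c hb)
    refine (hcont.tendsto.mono_left nhdsWithin_le_nhds).congr' ?_
    filter_upwards [eventually_not_isNegInt b, eventually_not_isNegInt_add b ((n : ℂ) - m + 1)]
      with b' h1 h2
    refine (closedFormInt_eq n m h1 ?_ hc0 (hadd hc1)).symm
    convert h2 using 2
    ring
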